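/- Let $\langle\cdot,\cdot\rangle$ be an inner product on $\mathbb{R}^n$. For a closed convex cone $K\subseteq\mathbb{R}^n$ write $x\preceq_K y$ if $y-x\in K$. A *sparsification function* for $K$ is a nonincreasing, upper semicontinuous function $\alpha:(0,1)\to\mathbb{R}$ such that for all finite families $x_1,\dots,x_m\in K$ with $\sum_{i=1}^m x_i=e\in\operatorname{relint}(K)$ and all $0<\epsilon<1$ there are $S\subseteq\{1,\dots,m\}$ with $|S|\le\alpha(\epsilon)$ and positive scalars $(\lambda_i)_{i\in S}$ with $$(1-\epsilon)e\preceq_K\sum_{i\in S}\lambda_i x_i\preceq_K(1+\epsilon)e .$$ The function $\mathrm{sp}_K:(0,1)\to\mathbb{R}$ is the pointwise infimum of all sparsification functions for $K$. Let $p$ be a real polynomial in $n$ variables, homogeneous of degree $d$ and hyperbolic with respect to $e\in\mathbb{R}^n$, i.e. $p(e)>0$ and for every $x\in\mathbb{R}^n$ all complex roots $t$ of $p(te-x)=0$ are real. Let $\Lambda_+=\{x\in\mathbb{R}^n : \text{all roots } t \text{ of } p(te-x)=0 \text{ are nonnegative}\}$ be its hyperbolicity cone and $\Lambda_+^*=\{y\in\mathbb{R}^n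 : \langle y,x\rangle\ge 0\text{ for all }x\in\Lambda_+\}$ the dual cone. Then $\mathrm{sp}_{\Lambda_+^*}$ is a well-defined sparsification function for $\Lambda_+^*$, and $$\mathrm{sp}_{\Lambda_+^*}(\epsilon)\le\left\lceil\left(\frac{4d}{\epsilon}\right)^2\right\rceil\qquad\text{for all }\epsilon\in(0,1).$$ -/

import Mathlib

/-- The real polynomial `p` in `n` variables is homogeneous of degree `d` and hyperbolic with
respect to `e`: `p(e) > 0` and, for every real `x`, all complex roots `t` of `p(te - x)` are
real. -/
structure IsHyperbolic {n : ℕ} (p : MvPolynomial (Fin n) ℝ) (d : ℕ) (e : Fin n → ℝ) : Prop where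
  homogeneous : p.IsHomogeneous d
  pos : 0 < MvPolynomial.eval e p
  real_roots : ∀ (x : Fin n → ℝ) (t : ℂ),
    MvPolynomial.aeval (fun i => t * (e i : ℂ) - (x i : ℂ)) p = 0 → t.im = 0

/-- The hyperbolicity cone `Λ₊(p, e)`: the points `x` all of whose hyperbolic eigenvalues, that is
the (real) roots `t` of `p(te - x)`, are nonnegative. -/
def hyperbolicityCone {n : ℕ} (p : MvPolynomial (Fin n) ℝ) (e : Fin n → ℝ) : Set (Fin n → ℝ) :=
  {x | ∀ t : ℝ, MvPolynomial.eval (t • e - x) p = 0 → 0 ≤ t}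

/-- `α : (0,1) → ℝ` is a sparsification function for the convex cone `K`: it is nonincreasing and
upper semicontinuous, and whenever finitely many elements `x i` of `K` sum to a point `e` of the
relative interior of `K` and `0 < ε < 1`, at most `α ε` of them have a combination with positive
coefficients that lies between `(1 - ε) e` and `(1 + ε) e` in the order `u ≼ v ↔ v - u ∈ K`. -/
structure IsSparsificationFunction {V : Type*} [AddCommGroup V] [Module ℝ V] [TopologicalSpace V]
    (K : PointedCone ℝ V) (α : Set.Ioo (0 : ℝ) 1 → ℝ) : Prop where
  antitone : Antitone α
  upperSemicontinuous : UpperSemicontinuous α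
  sparsifies : ∀ (m : ℕ) (x : Fin m → V), (∀ i, x i ∈ K) →
    ∑ i, x i ∈ intrinsicInterior ℝ (K : Set V) →
    ∀ ε : Set.Ioo (0 : ℝ) 1, ∃ (S : Finset (Fin m)) (c : Fin m → ℝ),
      (S.card : ℝ) ≤ α ε ∧ (∀ i ∈ S, 0 < c i) ∧
      ∑ i ∈ S, c i • x i - (1 - (ε : ℝ)) • ∑ i, x i ∈ K ∧
      (1 + (ε : ℝ)) • ∑ i, x i - ∑ i ∈ S, c i • x i ∈ K

/-- The sparsification function `sp_K` of `K`: the pointwise infimum of all sparsification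
functions for `K`. -/
noncomputable def sp {V : Type*} [AddCommGroup V] [Module ℝ V] [TopologicalSpace V]
    (K : PointedCone ℝ V) (ε : Set.Ioo (0 : ℝ) 1) : ℝ :=
  ⨅ α : {α : Set.Ioo (0 : ℝ) 1 → ℝ // IsSparsificationFunction K α}, α.1 ε

/-! The barrier `-log p` supplies one quadratic form that controls both the hyperbolicity cone and
the given family in its dual. Let `φ` be the functional of the sum of the `x i`. If `d > 0`,
maximizing `p` on the slice `φ = d` of the cone, modulo lineality, gives an interior point `z` at
which the derivative of `log p` is `φ` (`IsHyperbolic.exists_gradLog_eq`). Let `H` be the negated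
Hessian of `log p` at `z`. Along any line through `z` the polynomial factors into real linear
factors (`IsHyperbolic.exists_spectrum`), so `φ` and `H` are the sum and the sum of squares of
eigenvalues.

Two facts follow. The `H`-unit ball around `z` lies in the cone, so each functional `f i` of the
family has dual `H`-norm at most `f i z`, and these values add up to `φ z = d`. On the cone the
eigenvalues are nonnegative, hence `√(H u u) ≤ φ u`.

Thus `φ / d` is a convex combination of vectors in the dual unit ball. Approximate Carathéodory
(`exists_multiplicities`) replaces it by an average of `N` of them with error `1/√N`. For `N ≥
(d/ε)²` the error against `φ` is at most `ε √(H u u) ≤ ε φ u` on the cone, which is the two-sided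
bound.

Convexity of the cone and its independence of the direction `e` are Gårding's theorem, proved by
following complex zeros along paths. -/

/-! ### Restriction of a homogeneous polynomial to lines -/

open Polynomial in
/-- The restriction of `p` to the line through `u` in direction `v`: the polynomial `p(u + Xv)`. -/
noncomputable def lineRestrict {n : ℕ} {A : Type*} [CommRing A] [Algebra ℝ A]
    (p : MvPolynomial (Fin n) ℝ) (u v : Fin n → A) : A[X] :=
  MvPolynomial.aeval (fun i => C (u i) + C (v i) * X) p

section lineRestrict

open Polynomial

variable {n : ℕ} {A : Type*} [CommRing A] [Algebra ℝ A]

theorem eval_lineRestrict (p : MvPolynomial (Fin n) ℝ) (u v : Fin n → A) (t : A) :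
    (lineRestrict p u v).eval t = MvPolynomial.aeval (fun i => u i + v i * t) p := by
  rw [lineRestrict, ← coe_evalRingHom, MvPolynomial.map_aeval, MvPolynomial.aeval_def,
    MvPolynomial.coe_eval₂Hom]
  congr 1
  · ext r
    simp [Polynomial.algebraMap_apply]
  · ext i
    simp

theorem natDegree_lineRestrict_le {p : MvPolynomial (Fin n) ℝ} {d : ℕ} (hp : p.IsHomogeneous d)
    (u v : Fin n → A) : (lineRestrict p u v).natDegree ≤ d := by
  have := MvPolynomial.aeval_natDegree_le (R := A) (m := d) (n := 1)
    (MvPolynomial.map (algebraMap ℝ A) p)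
    ((hp.map _).totalDegree_le) (fun i => C (u i) + C (v i) * X) (fun i => by compute_degree)
  rw [mul_one] at this
  convert this using 2
  rw [lineRestrict, MvPolynomial.aeval_map_algebraMap]

/-- Every monomial has degree exactly `d`, so `X ^ d` arises only by taking the `v`-term in each
factor. -/
theorem coeff_lineRestrict {p : MvPolynomial (Fin n) ℝ} {d : ℕ} (hp : p.IsHomogeneous d)
    (u v : Fin n → A) : (lineRestrict p u v).coeff d = MvPolynomial.aeval v p := by
  have key : ∀ (s : Finset (Fin n)) (m : Fin n → ℕ),
      (∏ i ∈ s, (C (u i) + C (v i) * X) ^ m i).natDegree ≤ ∑ i ∈ s, m i ∧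
      (∏ i ∈ s, (C (u i) + C (v i) * X) ^ m i).coeff (∑ i ∈ s, m i) = ∏ i ∈ s, v i ^ m i := by
    intro s m
    induction s using Finset.cons_induction with
    | empty => simp
    | cons a s ha ih =>
      have h1 : (C (u a) + C (v a) * X).natDegree ≤ 1 := by compute_degree
      have h2 : ((C (u a) + C (v a) * X) ^ m a).natDegree ≤ m a := by
        simpa using natDegree_pow_le_of_le (m a) h1
      rw [Finset.prod_cons, Finset.sum_cons, Finset.prod_cons]
      refine ⟨natDegree_mul_le_of_le h2 ih.1, ?_⟩
      rw [coeff_mul_add_eq_of_natDegree_le h2 ih.1, ih.2]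
      congr 1
      simpa using coeff_pow_of_natDegree_le (m := m a) h1
  rw [lineRestrict, MvPolynomial.aeval_eq_eval₂Hom, MvPolynomial.aeval_eq_eval₂Hom,
    MvPolynomial.coe_eval₂Hom, MvPolynomial.coe_eval₂Hom,
    MvPolynomial.eval₂_eq, MvPolynomial.eval₂_eq, finsetSum_coeff]
  refine Finset.sum_congr rfl fun m hm => ?_
  have hd := hp.degree_eq_sum_deg_support hm
  rw [Polynomial.algebraMap_apply, coeff_C_mul]
  congr 1
  rw [← (key m.support m).2]
  congr 1

theorem aeval_smul_of_isHomogeneous {p : MvPolynomial (Fin n) ℝ} {d : ℕ} (hp : p.IsHomogeneous d)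
    (c : A) (x : Fin n → A) :
    MvPolynomial.aeval (fun i => c * x i) p = c ^ d * MvPolynomial.aeval x p := by
  rw [MvPolynomial.aeval_eq_eval₂Hom, MvPolynomial.aeval_eq_eval₂Hom,
    MvPolynomial.coe_eval₂Hom, MvPolynomial.coe_eval₂Hom,
    MvPolynomial.eval₂_eq, MvPolynomial.eval₂_eq, Finset.mul_sum]
  refine Finset.sum_congr rfl fun m hm => ?_
  rw [hp.degree_eq_sum_deg_support hm]
  simp only [mul_pow, Finset.prod_mul_distrib, Finset.prod_pow_eq_pow_sum]
  rw [mul_left_comm]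

end lineRestrict

/-- A complex polynomial without zeros in the open upper half-plane is bounded below there by its
leading term. -/
theorem Polynomial.norm_coeff_mul_im_pow_le {q : Polynomial ℂ} {d : ℕ} (hd : q.natDegree ≤ d)
    (hq : ∀ t : ℂ, 0 < t.im → q.eval t ≠ 0) {t : ℂ} (ht : 0 ≤ t.im) :
    ‖q.coeff d‖ * t.im ^ d ≤ ‖q.eval t‖ := by
  rcases eq_or_lt_of_le hd with hd | hd
  · subst hd
    have hs := IsAlgClosed.splits q
    rw [hs.eval_eq_prod_roots, norm_mul, Polynomial.coeff_natDegree]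
    refine mul_le_mul_of_nonneg_left ?_ (norm_nonneg _)
    rw [hs.natDegree_eq_card_roots]
    have key : ∀ s : Multiset ℂ, (∀ r ∈ s, r.im ≤ 0) →
        t.im ^ s.card ≤ ‖(s.map (t - ·)).prod‖ := by
      intro s
      induction s using Multiset.induction_on with
      | empty => simp
      | cons a s ih =>
        intro h
        rw [Multiset.card_cons, Multiset.map_cons, Multiset.prod_cons, norm_mul, pow_succ']
        refine mul_le_mul ?_ (ih fun r hr => h r (Multiset.mem_cons_of_mem hr))
          (pow_nonneg ht _) (norm_nonneg _)
        have := h a (Multiset.mem_cons_self a s)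
        -- Every root lies in the closed lower half-plane, so its distance from `t` is at least
        -- `t.im`.
        calc t.im ≤ (t - a).im := by simp [this]
          _ ≤ ‖t - a‖ := (le_abs_self _).trans (Complex.abs_im_le_norm _)
    refine key _ fun r hr => ?_
    by_contra hlt
    exact hq r (not_le.1 hlt) (Polynomial.isRoot_of_mem_roots hr)
  · simp [Polynomial.coeff_eq_zero_of_natDegree_lt hd]

/-! ### Gårding's theory: convexity and direction-independence of the cone -/

section Garding

open MvPolynomial Complex

variable {n d : ℕ} {p : MvPolynomial (Fin n) ℝ} {e : Fin n → ℝ}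

theorem continuous_aeval_complex (p : MvPolynomial (Fin n) ℝ) :
    Continuous fun w : Fin n → ℂ => aeval w p := by
  have : (fun w : Fin n → ℂ => aeval w p) = fun w => eval w (map (algebraMap ℝ ℂ) p) := by
    ext w
    rw [eval_map, aeval_def]
  rw [this]
  exact MvPolynomial.continuous_eval _

theorem aeval_ofReal (p : MvPolynomial (Fin n) ℝ) (x : Fin n → ℝ) :
    aeval (fun i => (x i : ℂ)) p = (eval x p : ℂ) := by
  have := MvPolynomial.aeval_algebraMap_apply (A := ℝ) ℂ x p
  simpa [Function.comp_def, MvPolynomial.aeval_eq_eval] using this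

theorem eval_smul_of_isHomogeneous (hp : p.IsHomogeneous d) (c : ℝ) (x : Fin n → ℝ) :
    eval (c • x) p = c ^ d * eval x p := by
  have := aeval_smul_of_isHomogeneous hp c x
  simpa [MvPolynomial.aeval_eq_eval, Pi.smul_def] using this

theorem le_apply_zero_of_forall_pos {f : ℝ → ℝ} (hf : Continuous f) {c : ℝ}
    (h : ∀ a, 0 < a → c ≤ f a) : c ≤ f 0 := by
  have h1 : Filter.Tendsto f (nhdsWithin 0 (Set.Ioi 0)) (nhds (f 0)) :=
    hf.continuousAt.tendsto.mono_left nhdsWithin_le_nhds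
  exact ge_of_tendsto h1 (by filter_upwards [self_mem_nhdsWithin] with a ha using h a ha)

/-- Restricting to a line in a direction `b` with `p b ≠ 0`: if there are no zeros in the open upper
half-plane, `p` is bounded below there. -/
theorem norm_aeval_ge (hp : p.IsHomogeneous d) (b : Fin n → ℝ) (u : Fin n → ℂ)
    (h : ∀ t : ℂ, 0 < t.im → aeval (fun i => u i + b i * t) p ≠ 0) {t : ℂ} (ht : 0 ≤ t.im) :
    |eval b p| * t.im ^ d ≤ ‖aeval (fun i => u i + b i * t) p‖ := by
  have := Polynomial.norm_coeff_mul_im_pow_le (natDegree_lineRestrict_le hp u fun i => (b i : ℂ))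
    (fun t ht => by rw [eval_lineRestrict]; exact h t ht) ht
  rwa [coeff_lineRestrict hp, eval_lineRestrict, aeval_ofReal, norm_real, Real.norm_eq_abs] at this

/-- Zeros of `p(u + tb)` cannot enter the closed upper half-plane along a path `u` on which no real
zeros occur. -/
theorem aeval_ne_zero_of_path (hp : p.IsHomogeneous d) {b : Fin n → ℝ} (hb : eval b p ≠ 0)
    {u : unitInterval → Fin n → ℂ} (hu : Continuous u)
    (hreal : ∀ (r : unitInterval) (t : ℝ), aeval (fun i => u r i + b i * t) p ≠ 0)
    (h0 : ∀ t : ℂ, 0 ≤ t.im → aeval (fun i => u 0 i + b i * t) p ≠ 0)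
    (r : unitInterval) {t : ℂ} (ht : 0 ≤ t.im) : aeval (fun i => u r i + b i * t) p ≠ 0 := by
  have hcont : Continuous fun x : unitInterval × ℂ => aeval (fun i => u x.1 i + b i * x.2) p :=
    (continuous_aeval_complex p).comp (by fun_prop)
  set A : Set unitInterval :=
    {r | ∀ t : ℂ, 0 ≤ t.im → aeval (fun i => u r i + b i * t) p ≠ 0} with hA
  -- The quantitative bound is a closed condition. It excludes zeros with positive imaginary part;
  -- `hreal` excludes the real ones.
  have hclosed : IsClosed A := by
    have : A = ⋂ (t : ℂ) (_ : 0 ≤ t.im),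
        {r | |eval b p| * t.im ^ d ≤ ‖aeval (fun i => u r i + b i * t) p‖} := by
      ext r
      simp only [hA, Set.mem_ofPred_eq, Set.mem_iInter]
      constructor
      · intro h t ht
        exact norm_aeval_ge hp b (u r) (fun t ht => h t ht.le) ht
      · intro h t ht h'
        rcases ht.eq_or_lt with ht' | ht'
        · refine hreal r t.re ?_
          rwa [show ((t.re : ℝ) : ℂ) = t from Complex.ext (by simp) (by simpa using ht')]
        · have := h t ht
          rw [h', norm_zero] at this
          exact absurd this (not_le.2 (by positivity))
    rw [this]
    refine isClosed_iInter fun t => isClosed_iInter fun _ => isClosed_le continuous_const ?_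
    exact (hcont.comp (by fun_prop : Continuous fun r : unitInterval => (r, t))).norm
  -- Since `p b ≠ 0`, zeros `t` stay in a fixed disc, so the complement of `A` is the projection of
  -- a compact set.
  have hopen : IsOpen A := by
    rw [← isClosed_compl_iff]
    obtain ⟨M, hM⟩ := (isCompact_range hu).isBounded.exists_norm_le
    obtain ⟨η, hη, hball⟩ : ∃ η > 0, ∀ w : Fin n → ℂ, ‖w‖ < η →
        aeval (fun i => w i + b i) p ≠ 0 := by
      have hc : Continuous fun w : Fin n → ℂ => aeval (fun i => w i + (b i : ℂ)) p :=
        (continuous_aeval_complex p).comp (by fun_prop)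
      have h1 : aeval (fun i => (0 : Fin n → ℂ) i + (b i : ℂ)) p ≠ 0 := by
        simpa [aeval_ofReal] using hb
      obtain ⟨η, hη, h⟩ := Metric.eventually_nhds_iff.1 (hc.continuousAt.eventually_ne h1)
      exact ⟨η, hη, fun w hw => h (by simpa using hw)⟩
    have hM0 : 0 ≤ M := (norm_nonneg _).trans (hM (u 0) ⟨0, rfl⟩)
    have hcomp : Aᶜ = Prod.fst '' ((Set.univ ×ˢ Metric.closedBall (0 : ℂ) (M / η + 1)) ∩
        {x : unitInterval × ℂ | 0 ≤ x.2.im ∧ aeval (fun i => u x.1 i + b i * x.2) p = 0}) := by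
      ext r
      simp only [hA, Set.mem_compl_iff, Set.mem_ofPred_eq, Set.mem_image, Set.mem_inter_iff,
        Set.mem_prod, Set.mem_univ, true_and, Prod.exists, exists_and_right, exists_eq_right]
      push Not
      refine ⟨fun ⟨t, ht, h⟩ => ⟨t, ?_, ht, h⟩, fun ⟨t, _, ht, h⟩ => ⟨t, ht, h⟩⟩
      by_contra hlt
      rw [mem_closedBall_zero_iff, not_le] at hlt
      have htpos : 0 < ‖t‖ := lt_of_le_of_lt (by positivity) hlt
      have ht0 : t ≠ 0 := norm_pos_iff.1 htpos
      refine hball (t⁻¹ • u r) ?_ ?_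
      · rw [norm_smul, norm_inv, inv_mul_lt_iff₀ htpos]
        have h1 := hM (u r) ⟨r, rfl⟩
        have h2 : M / η < ‖t‖ := by linarith
        rw [div_lt_iff₀ hη] at h2
        exact h1.trans_lt h2
      · have h1 := aeval_smul_of_isHomogeneous hp t (fun i => (t⁻¹ • u r) i + (b i : ℂ))
        have h2 : (fun i => t * ((t⁻¹ • u r) i + (b i : ℂ))) = fun i => u r i + b i * t := by
          ext i
          simp only [Pi.smul_apply, smul_eq_mul]
          field_simp
        rw [h2, h] at h1
        exact (mul_eq_zero.1 h1.symm).resolve_left (pow_ne_zero _ ht0)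
    rw [hcomp]
    refine IsCompact.isClosed (IsCompact.image ?_ continuous_fst)
    refine (isCompact_univ.prod (isCompact_closedBall _ _)).inter_right ?_
    exact (isClosed_le continuous_const (continuous_im.comp continuous_snd)).inter (isClosed_eq hcont continuous_const)
  have huniv : A = Set.univ := IsClopen.eq_univ ⟨hclosed, hopen⟩ ⟨0, h0⟩
  have hr : r ∈ A := huniv ▸ Set.mem_univ r
  exact hr t ht

/-- The open hyperbolicity cone: the points `x` such that `p` does not vanish on the ray from `x` in
direction `e`. -/
def openHyperbolicityCone (p : MvPolynomial (Fin n) ℝ) (e : Fin n → ℝ) : Set (Fin n → ℝ) :=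
  {x | ∀ s : ℝ, 0 ≤ s → eval (x + s • e) p ≠ 0}

theorem IsHyperbolic.aeval_ne_zero (hp : IsHyperbolic p d e) (x : Fin n → ℝ) {t : ℂ}
    (ht : t.im ≠ 0) : aeval (fun i => (x i : ℂ) + e i * t) p ≠ 0 := by
  intro h
  refine ht (hp.real_roots (-x) t ?_)
  rw [← h]
  congr 2
  ext i
  simp [mul_comm, add_comm]

/-- The shift by `a * I * e` keeps zeros off the real axis, which allows `x` to be contracted to `0`
along a path. -/
theorem IsHyperbolic.aeval_add_ne_zero (hp : IsHyperbolic p d e) {b : Fin n → ℝ}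
    (hb : b ∈ openHyperbolicityCone p e) (x : Fin n → ℝ) {a : ℝ} (ha : 0 < a) {t : ℂ}
    (ht : 0 ≤ t.im) : aeval (fun i => ((x i : ℂ) + a * I * e i) + b i * t) p ≠ 0 := by
  have hb0 : eval b p ≠ 0 := by simpa using hb 0 le_rfl
  have := aeval_ne_zero_of_path hp.homogeneous hb0
    (u := fun r i => ((r : ℝ) : ℂ) * (x i : ℂ) + a * I * e i) (by fun_prop) ?_ ?_ 1 ht
  · simpa using this
  · intro r t
    have := hp.aeval_ne_zero ((r : ℝ) • x + t • b) (t := a * I) (by simpa using ha.ne')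
    convert this using 4 with i
    simp
    ring
  -- At the start of the path, homogeneity turns a zero into a real zero `s = a * I / t` of `p(b + s
  -- e)`. Then `s < 0`, against `a = s * t.im`.
  · intro t ht h
    by_cases ht0 : t = 0
    · refine hp.aeval_ne_zero 0 (t := a * I) (by simpa using ha.ne') ?_
      rw [← h]
      congr 2
      ext i
      simp [ht0, mul_comm]
    · have h1 := aeval_smul_of_isHomogeneous hp.homogeneous t
        (fun i => (b i : ℂ) + e i * (a * I / t))
      have h2 : (fun i => t * ((b i : ℂ) + e i * (a * I / t))) =
          fun i => (((0 : unitInterval) : ℝ) : ℂ) * (x i : ℂ) + a * I * e i + b i * t := by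
        ext i
        simp
        field_simp
        ring
      rw [h2, h] at h1
      have h3 := (mul_eq_zero.1 h1.symm).resolve_left (pow_ne_zero _ ht0)
      have h4 : (a * I / t).im = 0 := by
        by_contra h5
        exact hp.aeval_ne_zero b h5 h3
      have h5 : a * I / t = (((a * I / t).re : ℝ) : ℂ) := Complex.ext (by simp) (by simpa using h4)
      set s := (a * I / t).re
      rw [h5] at h3
      have h6 : eval (b + s • e) p = 0 := by
        have := aeval_ofReal p (b + s • e)
        rw [← ofReal_eq_zero, ← this, ← h3]
        congr 2
        ext i
        simp [mul_comm]
      have hs : s < 0 := by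
        by_contra hs
        exact hb s (not_lt.1 hs) h6
      have h7 : a * I = s * t := by rw [← h5]; field_simp
      have h8 : a = s * t.im := by simpa using congrArg Complex.im h7
      nlinarith

/-- Up to scaling, the segment from `b` to `e` lies on the ray from `b` in direction `e`, so `p`
keeps its sign on it. -/
theorem IsHyperbolic.eval_pos_of_mem (hp : IsHyperbolic p d e) {b : Fin n → ℝ}
    (hb : b ∈ openHyperbolicityCone p e) : 0 < eval b p := by
  by_contra hneg
  have hc : Continuous fun r : ℝ => eval ((1 - r) • b + r • e) p :=
    (MvPolynomial.continuous_eval p).comp (by fun_prop)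
  have h0 : (0 : ℝ) ∈ Set.Icc (eval (((1 : ℝ) - 0) • b + (0 : ℝ) • e) p)
      (eval (((1 : ℝ) - 1) • b + (1 : ℝ) • e) p) := by
    simpa using ⟨not_lt.1 hneg, hp.pos.le⟩
  obtain ⟨r, hr, h⟩ := intermediate_value_Icc zero_le_one hc.continuousOn h0
  simp only at h
  rcases hr.2.eq_or_lt with rfl | hr1
  · simp only [sub_self, zero_smul, one_smul, zero_add] at h
    exact hp.pos.ne' h
  · have hr' : 0 < 1 - r := by linarith
    have : (1 - r) • b + r • e = (1 - r) • (b + (r / (1 - r)) • e) := by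
      rw [smul_add, smul_smul, mul_div_cancel₀ _ hr'.ne']
    rw [this, eval_smul_of_isHomogeneous hp.homogeneous] at h
    exact hb _ (div_nonneg hr.1 hr'.le)
      ((mul_eq_zero.1 h).resolve_left (pow_ne_zero _ hr'.ne'))

theorem IsHyperbolic.eval_neg (hp : IsHyperbolic p d e) (x : Fin n → ℝ) :
    eval (-x) p = (-1) ^ d * eval x p := by
  rw [← neg_one_smul ℝ x, eval_smul_of_isHomogeneous hp.homogeneous]

/-- `p` is hyperbolic with respect to every point of its open hyperbolicity cone. -/
theorem IsHyperbolic.of_mem (hp : IsHyperbolic p d e) {b : Fin n → ℝ}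
    (hb : b ∈ openHyperbolicityCone p e) : IsHyperbolic p d b := by
  have hpos := hp.eval_pos_of_mem hb
  have upper : ∀ (x : Fin n → ℝ) (t : ℂ), 0 < t.im →
      aeval (fun i => (x i : ℂ) + b i * t) p ≠ 0 := by
    intro x t ht h
    -- The lower bound does not depend on the shift `a`, so it survives `a → 0`.
    have hc : Continuous fun a : ℝ =>
        ‖aeval (fun i => ((x i : ℂ) + a * I * e i) + b i * t) p‖ :=
      ((continuous_aeval_complex p).comp (by fun_prop)).norm
    have := le_apply_zero_of_forall_pos hc (c := |eval b p| * t.im ^ d) fun a ha =>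
      norm_aeval_ge hp.homogeneous b (fun i => (x i : ℂ) + a * I * e i)
        (fun t ht => hp.aeval_add_ne_zero hb x ha ht.le) ht.le
    simp only [ofReal_zero, zero_mul, add_zero, h, norm_zero] at this
    exact absurd this (not_le.2 (by positivity))
  refine ⟨hp.homogeneous, hpos, fun x t h => ?_⟩
  have hx : ∀ t : ℂ, aeval (fun i => t * (b i : ℂ) - (x i : ℂ)) p =
      aeval (fun i => ((-x) i : ℂ) + b i * t) p := by
    intro t
    congr 2
    ext i
    simp [mul_comm, add_comm, sub_eq_add_neg]
  rcases lt_trichotomy t.im 0 with hlt | heq | hgt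
  · exfalso
    refine upper (-x) (conjAe t) (by simpa using hlt) ?_
    rw [← hx]
    have := comp_aeval_apply (fun i => t * (b i : ℂ) - (x i : ℂ)) conjAe.toAlgHom p
    rw [h, map_zero] at this
    rw [this]
    congr 2
    ext i
    simp
  · exact heq
  · exact absurd (hx t ▸ h) (upper (-x) t hgt)

theorem IsHyperbolic.self_mem (hp : IsHyperbolic p d e) : e ∈ openHyperbolicityCone p e := by
  intro s hs
  have : e + s • e = (1 + s) • e := by rw [add_smul, one_smul]
  rw [this, eval_smul_of_isHomogeneous hp.homogeneous]
  exact mul_ne_zero (pow_ne_zero _ (by positivity)) hp.pos.ne'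

theorem IsHyperbolic.mem_symm (hp : IsHyperbolic p d e) {b : Fin n → ℝ}
    (hb : b ∈ openHyperbolicityCone p e) : e ∈ openHyperbolicityCone p b := by
  intro s hs
  rcases hs.eq_or_lt with rfl | hs
  · simpa using hp.pos.ne'
  · have : e + s • b = s • (b + s⁻¹ • e) := by
      rw [smul_add, smul_smul, mul_inv_cancel₀ hs.ne', one_smul, add_comm]
    rw [this, eval_smul_of_isHomogeneous hp.homogeneous]
    exact mul_ne_zero (pow_ne_zero _ hs.ne') (hb _ (by positivity))

/-- Moving from `e` to `c` within the open cone, no real zero `t` can occur, because `p` is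
hyperbolic in every direction met on the way. Setting `t = s * I` later yields positivity on real
combinations of `b` and `c`. -/
theorem IsHyperbolic.aeval_I_mul_add_ne_zero (hp : IsHyperbolic p d e) {b c : Fin n → ℝ}
    (hb : b ∈ openHyperbolicityCone p e) (hc : c ∈ openHyperbolicityCone p e) {t : ℂ}
    (ht : 0 ≤ t.im) : aeval (fun i => I * c i + b i * t) p ≠ 0 := by
  have := aeval_ne_zero_of_path hp.homogeneous (hp.eval_pos_of_mem hb).ne'
    (u := fun r i => I * ((1 - ((r : ℝ) : ℂ)) * (e i : ℂ) + ((r : ℝ) : ℂ) * c i))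
    (by fun_prop) ?_ ?_ 1 ht
  · simpa using this
  · intro r t
    have hr : (1 - (r : ℝ)) • e + (r : ℝ) • c ∈ openHyperbolicityCone p e := by
      intro s hs
      rcases r.2.1.eq_or_lt with h0 | h0
      · rw [← h0]
        simpa using hp.self_mem s hs
      · have : (1 - (r : ℝ)) • e + (r : ℝ) • c + s • e =
            (r : ℝ) • (c + ((1 - r + s) / r : ℝ) • e) := by
          rw [smul_add, smul_smul, mul_div_cancel₀ _ h0.ne']
          module
        rw [this, eval_smul_of_isHomogeneous hp.homogeneous]
        refine mul_ne_zero (pow_ne_zero _ h0.ne') (hc _ ?_)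
        have := r.2.2
        exact div_nonneg (by linarith) h0.le
    have := (hp.of_mem hr).aeval_ne_zero (t • b) (t := I) (by simp)
    convert this using 4 with i
    simp
    ring
  · intro t ht
    have := hp.aeval_add_ne_zero hb 0 one_pos ht
    simpa using this

theorem aeval_I_mul (hp : p.IsHomogeneous d) (c b : Fin n → ℝ) (s : ℝ) :
    aeval (fun i => I * (c i : ℂ) + b i * (s * I)) p = I ^ d * (eval (c + s • b) p : ℂ) := by
  rw [← aeval_ofReal, ← aeval_smul_of_isHomogeneous hp]
  congr 2
  ext i
  simp
  ring

theorem IsHyperbolic.mem_openHyperbolicityCone_iff (hp : IsHyperbolic p d e) {x : Fin n → ℝ} :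
    x ∈ openHyperbolicityCone p e ↔ x ∈ hyperbolicityCone p e ∧ eval x p ≠ 0 := by
  have key : ∀ s : ℝ, eval (s • e - x) p = (-1) ^ d * eval (x + (-s) • e) p := by
    intro s
    rw [← hp.eval_neg]
    congr 2
    module
  constructor
  · refine fun h => ⟨fun t ht => ?_, by simpa using h 0 le_rfl⟩
    by_contra hlt
    rw [key] at ht
    exact h (-t) (by linarith) ((mul_eq_zero.1 ht).resolve_left (pow_ne_zero _ (by norm_num)))
  · rintro ⟨h, h0⟩ s hs hs'
    have := h (-s) (by rw [key, neg_neg, hs', mul_zero])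
    obtain rfl : s = 0 := by linarith
    simp [h0] at hs'

theorem IsHyperbolic.add_smul_mem (hp : IsHyperbolic p d e) {x : Fin n → ℝ}
    (hx : x ∈ hyperbolicityCone p e) {s : ℝ} (hs : 0 < s) :
    x + s • e ∈ openHyperbolicityCone p e := by
  intro r hr h
  have := hx (-(s + r)) ?_
  · linarith
  · have h1 : -(s + r) • e - x = -(x + s • e + r • e) := by module
    rw [h1, hp.eval_neg, h, mul_zero]

/-- Closed plus open hyperbolicity cone points: quantitative positivity. -/
theorem IsHyperbolic.le_eval_add_smul (hp : IsHyperbolic p d e) {b x : Fin n → ℝ}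
    (hb : b ∈ openHyperbolicityCone p e) (hx : x ∈ hyperbolicityCone p e) {s : ℝ} (hs : 0 ≤ s) :
    eval b p * s ^ d ≤ |eval (x + s • b) p| := by
  have hc : Continuous fun a : ℝ => |eval (x + a • e + s • b) p| :=
    ((MvPolynomial.continuous_eval p).comp (by fun_prop)).abs
  have := le_apply_zero_of_forall_pos hc (c := eval b p * s ^ d) fun a ha => by
    have h1 := norm_aeval_ge hp.homogeneous b (fun i => I * ((x + a • e) i : ℂ))
      (fun t ht => hp.aeval_I_mul_add_ne_zero hb (hp.add_smul_mem hx ha) ht.le) (t := s * I) (by simpa using hs)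
    rw [aeval_I_mul hp.homogeneous] at h1
    simpa [abs_of_pos (hp.eval_pos_of_mem hb)] using h1
  simpa using this

theorem IsHyperbolic.hyperbolicityCone_subset (hp : IsHyperbolic p d e) {b : Fin n → ℝ}
    (hb : b ∈ openHyperbolicityCone p e) : hyperbolicityCone p e ⊆ hyperbolicityCone p b := by
  intro x hx t ht
  by_contra hlt
  have hneg : 0 < -t := by linarith
  have h1 := hp.le_eval_add_smul hb hx hneg.le
  have h2 : eval (x + (-t) • b) p = 0 := by
    have : x + (-t) • b = -(t • b - x) := by module
    rw [this, hp.eval_neg, ht, mul_zero]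
  rw [h2, abs_zero] at h1
  have := hp.eval_pos_of_mem hb
  exact absurd h1 (not_le.2 (by positivity))

/-- The hyperbolicity cone does not depend on the choice of the direction in its open part. -/
theorem IsHyperbolic.hyperbolicityCone_eq (hp : IsHyperbolic p d e) {b : Fin n → ℝ}
    (hb : b ∈ openHyperbolicityCone p e) : hyperbolicityCone p b = hyperbolicityCone p e :=
  ((hp.of_mem hb).hyperbolicityCone_subset (hp.mem_symm hb)).antisymm
    (hp.hyperbolicityCone_subset hb)

theorem IsHyperbolic.mem_hyperbolicityCone_iff (hp : IsHyperbolic p d e) {x : Fin n → ℝ} :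
    x ∈ hyperbolicityCone p e ↔ ∀ s : ℝ, 0 ≤ s → eval e p * s ^ d ≤ |eval (x + s • e) p| := by
  refine ⟨fun hx s hs => hp.le_eval_add_smul hp.self_mem hx hs, fun h t ht => ?_⟩
  by_contra hlt
  have hneg : 0 < -t := by linarith
  have h1 := h (-t) hneg.le
  have h2 : eval (x + (-t) • e) p = 0 := by
    have : x + (-t) • e = -(t • e - x) := by module
    rw [this, hp.eval_neg, ht, mul_zero]
  rw [h2, abs_zero] at h1
  have := hp.pos
  exact absurd h1 (not_le.2 (by positivity))

theorem IsHyperbolic.isClosed_hyperbolicityCone (hp : IsHyperbolic p d e) :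
    IsClosed (hyperbolicityCone p e) := by
  have : hyperbolicityCone p e =
      ⋂ (s : ℝ) (_ : 0 ≤ s), {x | eval e p * s ^ d ≤ |eval (x + s • e) p|} := by
    ext x
    simp [hp.mem_hyperbolicityCone_iff]
  rw [this]
  refine isClosed_iInter fun s => isClosed_iInter fun _ => isClosed_le continuous_const ?_
  exact ((MvPolynomial.continuous_eval p).comp (by fun_prop)).abs

theorem IsHyperbolic.add_mem (hp : IsHyperbolic p d e) {x y : Fin n → ℝ}
    (hx : x ∈ hyperbolicityCone p e) (hy : y ∈ hyperbolicityCone p e) :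
    x + y ∈ hyperbolicityCone p e := by
  intro t ht
  by_contra hlt
  have hneg : 0 < -t := by linarith
  have hz := hp.add_smul_mem hx hneg
  -- A negative root `t` for `x + y` would be a zero of `p` at `y` plus the interior point `x - t
  -- e`.
  have h1 := hp.le_eval_add_smul hz hy zero_le_one
  have h2 : y + (1 : ℝ) • (x + (-t) • e) = -(t • e - (x + y)) := by module
  rw [h2, hp.eval_neg, ht, mul_zero, abs_zero, one_pow, mul_one] at h1
  exact absurd h1 (not_le.2 (hp.eval_pos_of_mem hz))

theorem IsHyperbolic.smul_mem (hp : IsHyperbolic p d e) {x : Fin n → ℝ}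
    (hx : x ∈ hyperbolicityCone p e) {c : ℝ} (hc : 0 ≤ c) : c • x ∈ hyperbolicityCone p e := by
  rcases hc.eq_or_lt with rfl | hc
  · rw [zero_smul, hp.mem_hyperbolicityCone_iff]
    intro s hs
    rw [zero_add, eval_smul_of_isHomogeneous hp.homogeneous, mul_comm]
    exact le_abs_self _
  · intro t ht
    have h1 : t • e - c • x = c • ((t / c) • e - x) := by
      rw [smul_sub, smul_smul, mul_div_cancel₀ _ hc.ne']
    rw [h1, eval_smul_of_isHomogeneous hp.homogeneous] at ht
    have := hx _ ((mul_eq_zero.1 ht).resolve_left (pow_ne_zero _ hc.ne'))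
    have h2 := mul_nonneg this hc.le
    rwa [div_mul_cancel₀ _ hc.ne'] at h2

end Garding

/-! ### First and second derivatives of `log p` -/

section Barrier

open MvPolynomial

variable {n d : ℕ} {p : MvPolynomial (Fin n) ℝ} {z : Fin n → ℝ}

theorem derivative_lineRestrict (p : MvPolynomial (Fin n) ℝ) (u v : Fin n → ℝ) :
    Polynomial.derivative (lineRestrict p u v) =
      ∑ i, Polynomial.C (v i) * lineRestrict (pderiv i p) u v := by
  induction p using MvPolynomial.induction_on with
  | C a => simp [lineRestrict]
  | add p q hp hq =>
    simp only [lineRestrict, map_add, mul_add, Finset.sum_add_distrib] at hp hq ⊢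
    rw [hp, hq]
  | mul_X p j hp =>
    simp only [lineRestrict, map_mul, aeval_X, Derivation.leibniz, pderiv_X, smul_eq_mul, map_add,
      Polynomial.derivative_mul] at hp ⊢
    rw [hp]
    rw [Finset.sum_congr rfl fun i _ => mul_add _ _ _, Finset.sum_add_distrib, Finset.sum_mul,
      add_comm]
    congr 1
    · rw [Finset.sum_eq_single j]
      · simp
        ring
      · intro i _ hij
        simp [Pi.single_eq_of_ne' hij]
      · simp
    · exact Finset.sum_congr rfl fun i _ => by ring

/-- The derivative of `log p` at `z`. -/
noncomputable def gradLog (p : MvPolynomial (Fin n) ℝ) (z : Fin n → ℝ) : (Fin n → ℝ) →ₗ[ℝ] ℝ where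
  toFun h := (∑ i, h i * eval z (pderiv i p)) / eval z p
  map_add' h k := by simp [add_mul, Finset.sum_add_distrib, add_div]
  map_smul' c h := by simp [mul_assoc, ← Finset.mul_sum, mul_div_assoc]

/-- The bilinear form of second partial derivatives of `p` at `z`. -/
noncomputable def hessianForm (p : MvPolynomial (Fin n) ℝ) (z : Fin n → ℝ) :
    LinearMap.BilinForm ℝ (Fin n → ℝ) :=
  Matrix.toBilin' (Matrix.of fun i j => eval z (pderiv j (pderiv i p)))

/-- The negated Hessian of `log p` at `z`. -/
noncomputable def negHessLog (p : MvPolynomial (Fin n) ℝ) (z : Fin n → ℝ) :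
    LinearMap.BilinForm ℝ (Fin n → ℝ) :=
  -- Symmetrizing by hand makes commutation of partial derivatives unnecessary.
  LinearMap.mk₂ ℝ (fun h k => gradLog p z h * gradLog p z k -
      (hessianForm p z h k + hessianForm p z k h) / (2 * eval z p))
    (fun _ _ _ => by simp only [map_add, LinearMap.add_apply]; ring)
    (fun _ _ _ => by simp only [map_smul, LinearMap.smul_apply, smul_eq_mul]; ring)
    (fun _ _ _ => by simp only [map_add, LinearMap.add_apply]; ring)
    (fun _ _ _ => by simp only [map_smul, LinearMap.smul_apply, smul_eq_mul]; ring)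

theorem negHessLog_symm (p : MvPolynomial (Fin n) ℝ) (z h k : Fin n → ℝ) :
    negHessLog p z h k = negHessLog p z k h := by
  simp only [negHessLog, LinearMap.mk₂_apply]
  ring

theorem eval_lineRestrict_real (p : MvPolynomial (Fin n) ℝ) (u v : Fin n → ℝ) (s : ℝ) :
    (lineRestrict p u v).eval s = eval (u + s • v) p := by
  rw [eval_lineRestrict, aeval_eq_eval]
  congr 2
  ext i
  simp [mul_comm]

theorem coeff_one_lineRestrict (p : MvPolynomial (Fin n) ℝ) (hz : eval z p ≠ 0) (h : Fin n → ℝ) :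
    (lineRestrict p z h).coeff 1 = eval z p * gradLog p z h := by
  have h1 := Polynomial.coeff_derivative (lineRestrict p z h) 0
  rw [derivative_lineRestrict, Polynomial.coeff_zero_eq_eval_zero, Polynomial.eval_finsetSum] at h1
  simp only [Polynomial.eval_mul, Polynomial.eval_C, eval_lineRestrict_real, zero_smul, add_zero,
    zero_add, CharP.cast_eq_zero, mul_one] at h1
  simp only [gradLog, LinearMap.coe_mk, AddHom.coe_mk]
  rw [mul_div_cancel₀ _ hz, h1]

theorem coeff_two_lineRestrict (p : MvPolynomial (Fin n) ℝ) (z h : Fin n → ℝ) :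
    (lineRestrict p z h).coeff 2 * 2 = hessianForm p z h h := by
  have h1 := Polynomial.coeff_derivative (Polynomial.derivative (lineRestrict p z h)) 0
  have h2 := Polynomial.coeff_derivative (lineRestrict p z h) 1
  rw [h2, derivative_lineRestrict, Polynomial.coeff_zero_eq_eval_zero, Polynomial.derivative_sum,
    Polynomial.eval_finsetSum] at h1
  norm_num at h1
  rw [← h1, hessianForm, Matrix.toBilin'_apply]
  refine Finset.sum_congr rfl fun i _ => ?_
  rw [derivative_lineRestrict, Polynomial.eval_finsetSum, Finset.mul_sum]
  refine Finset.sum_congr rfl fun j _ => ?_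
  simp [eval_lineRestrict_real]
  ring

/-- Newton's identity: it converts Taylor coefficients at `z` into power sums of eigenvalues. -/
theorem Polynomial.coeff_multiset_prod_one_add (l : Multiset ℝ) :
    ((l.map fun a => (1 + C a * X : Polynomial ℝ)).prod).coeff 0 = 1 ∧
    ((l.map fun a => (1 + C a * X : Polynomial ℝ)).prod).coeff 1 = l.sum ∧
    ((l.map fun a => (1 + C a * X : Polynomial ℝ)).prod).coeff 2 * 2 =
      l.sum ^ 2 - (l.map (· ^ 2)).sum := by
  induction l using Multiset.induction_on with
  | empty => simp [Polynomial.coeff_one]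
  | cons a l ih =>
    obtain ⟨h0, h1, h2⟩ := ih
    simp only [Multiset.map_cons, Multiset.prod_cons, Multiset.sum_cons]
    set q := (l.map fun a => (1 + C a * X : Polynomial ℝ)).prod
    have e : (1 + C a * X) * q = q + C a * (X * q) := by ring
    rw [e]
    refine ⟨by simp [h0], by simp [h0, h1, add_comm], ?_⟩
    simp only [Polynomial.coeff_add, Polynomial.coeff_C_mul, Polynomial.coeff_X_mul]
    rw [h1]
    linear_combination h2

/-- The restriction of a hyperbolic polynomial to a line in a hyperbolic direction splits. -/
theorem IsHyperbolic.splits_lineRestrict (hp : IsHyperbolic p d z) (h : Fin n → ℝ) :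
    (lineRestrict p h z).Splits := by
  refine Polynomial.Splits.of_splits_map (algebraMap ℝ ℂ) (IsAlgClosed.splits _) fun t ht => ?_
  have h1 := Polynomial.isRoot_of_mem_roots ht
  rw [Polynomial.IsRoot.def, Polynomial.eval_map_algebraMap, lineRestrict, comp_aeval_apply] at h1
  have h2 : t.im = 0 := by
    by_contra h2
    refine hp.aeval_ne_zero h h2 ?_
    rw [← h1]
    congr 2
    ext i
    simp
  exact ⟨t.re, Complex.ext (by simp) (by simp [h2])⟩

/-- Spectral form of the restriction of `p` to a line through a hyperbolic direction `z`, and of the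
first two derivatives of `log p`. -/
theorem IsHyperbolic.exists_spectrum (hp : IsHyperbolic p d z) (h : Fin n → ℝ) :
    ∃ l : Multiset ℝ,
      (∀ s : ℝ, eval (z + s • h) p = eval z p * (l.map fun a => 1 + s * a).prod) ∧
      gradLog p z h = l.sum ∧ negHessLog p z h h = (l.map (· ^ 2)).sum := by
  have hs := hp.splits_lineRestrict h
  set q := lineRestrict p h z with hq
  have hcoeff : q.coeff d = eval z p := by
    rw [hq, coeff_lineRestrict hp.homogeneous, aeval_eq_eval]
  have hdeg : q.natDegree = d :=
    (natDegree_lineRestrict_le hp.homogeneous h z).antisymm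
      (Polynomial.le_natDegree_of_ne_zero (by rw [hcoeff]; exact hp.pos.ne'))
  have hlead : q.leadingCoeff = eval z p := by rw [Polynomial.leadingCoeff, hdeg, hcoeff]
  have hcard : q.roots.card = d := by rw [← hs.natDegree_eq_card_roots, hdeg]
  have key : ∀ s : ℝ,
      eval (z + s • h) p = eval z p * ((q.roots.map Neg.neg).map fun a => 1 + s * a).prod := by
    intro s
    rcases eq_or_ne s 0 with rfl | hs0
    · simp
    -- Reversal of the polynomial: the eigenvalues are the negated roots of `p(h + Xz)`, with zero
    -- roots retained.
    · have h1 : z + s • h = s • (h + s⁻¹ • z) := by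
        rw [smul_add, smul_smul, mul_inv_cancel₀ hs0, one_smul, add_comm]
      rw [h1, eval_smul_of_isHomogeneous hp.homogeneous, ← eval_lineRestrict_real,
        hs.eval_eq_prod_roots, hlead, Multiset.map_map, mul_left_comm]
      congr 1
      rw [← hcard, ← Multiset.prod_replicate, ← Multiset.map_const', ← Multiset.prod_map_mul]
      congr 1
      refine Multiset.map_congr rfl fun a _ => ?_
      simp only [Function.comp_apply]
      field_simp
      ring
  refine ⟨_, key, ?_⟩
  generalize q.roots.map Neg.neg = l at key ⊢
  have hpoly : lineRestrict p z h = Polynomial.C (eval z p) *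
      (l.map fun a => (1 + Polynomial.C a * Polynomial.X : Polynomial ℝ)).prod := by
    refine Polynomial.funext fun s => ?_
    rw [eval_lineRestrict_real, key, Polynomial.eval_mul, Polynomial.eval_C,
      Polynomial.eval_multiset_prod, Multiset.map_map]
    simp only [Function.comp_def, Polynomial.eval_add, Polynomial.eval_one, Polynomial.eval_mul,
      Polynomial.eval_C, Polynomial.eval_X, mul_comm s]
  obtain ⟨-, h1, h2⟩ := Polynomial.coeff_multiset_prod_one_add l
  have c1 := coeff_one_lineRestrict p hp.pos.ne' h
  have c2 := coeff_two_lineRestrict p z h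
  rw [hpoly, Polynomial.coeff_C_mul, h1] at c1
  rw [hpoly, Polynomial.coeff_C_mul, mul_assoc, h2] at c2
  have c1' := (mul_left_cancel₀ hp.pos.ne' c1).symm
  refine ⟨c1', ?_⟩
  simp only [negHessLog, LinearMap.mk₂_apply]
  rw [← c2, c1']
  have := hp.pos.ne'
  field_simp
  ring

theorem IsHyperbolic.negHessLog_nonneg (hp : IsHyperbolic p d z) (h : Fin n → ℝ) :
    0 ≤ negHessLog p z h h := by
  obtain ⟨l, -, -, h2⟩ := hp.exists_spectrum h
  rw [h2]
  exact Multiset.sum_nonneg (by simp only [Multiset.mem_map]; rintro _ ⟨a, _, rfl⟩; positivity)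

theorem Multiset.sum_sq_le_sq_sum {l : Multiset ℝ} (hl : ∀ a ∈ l, 0 ≤ a) :
    0 ≤ l.sum ∧ (l.map (· ^ 2)).sum ≤ l.sum ^ 2 := by
  induction l using Multiset.induction_on with
  | empty => simp
  | cons a l ih =>
    obtain ⟨h1, h2⟩ := ih fun b hb => hl b (Multiset.mem_cons_of_mem hb)
    have ha := hl a (Multiset.mem_cons_self a l)
    simp only [Multiset.map_cons, Multiset.sum_cons]
    exact ⟨add_nonneg ha h1, by nlinarith [mul_nonneg ha h1]⟩

theorem IsHyperbolic.negHessLog_le_sq (hp : IsHyperbolic p d z) {h : Fin n → ℝ}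
    (hh : h ∈ hyperbolicityCone p z) :
    0 ≤ gradLog p z h ∧ negHessLog p z h h ≤ gradLog p z h ^ 2 := by
  obtain ⟨l, h0, h1, h2⟩ := hp.exists_spectrum h
  rw [h1, h2]
  refine Multiset.sum_sq_le_sq_sum fun a ha => ?_
  by_contra hneg
  have hneg := not_le.1 hneg
  -- A negative eigenvalue `a` would make `p` vanish at `z - a⁻¹ h`, the sum of a cone point and
  -- `z`.
  have hs : 0 < -a⁻¹ := by simpa using hneg
  have h3 := h0 (-a⁻¹)
  rw [Multiset.prod_eq_zero (Multiset.mem_map.2 ⟨a, ha, by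
    rw [neg_mul, inv_mul_cancel₀ hneg.ne, add_neg_cancel]⟩), mul_zero] at h3
  have h4 := hp.mem_hyperbolicityCone_iff.1 (hp.smul_mem hh hs.le) 1 zero_le_one
  rw [one_smul, add_comm, h3, abs_zero, one_pow, mul_one] at h4
  exact absurd h4 (not_le.2 hp.pos)

/-- The Dikin ellipsoid at `z` is contained in the hyperbolicity cone. -/
theorem IsHyperbolic.sub_mem (hp : IsHyperbolic p d z) {h : Fin n → ℝ}
    (hh : negHessLog p z h h ≤ 1) : z - h ∈ hyperbolicityCone p z := by
  obtain ⟨l, h0, -, h2⟩ := hp.exists_spectrum h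
  intro t ht
  by_contra hneg
  have hneg := not_le.1 hneg
  have ht1 : t - 1 ≠ 0 := by linarith
  have h3 : t • z - (z - h) = (t - 1) • (z + (t - 1)⁻¹ • h) := by
    rw [smul_add, smul_smul, mul_inv_cancel₀ ht1]
    module
  rw [h3, eval_smul_of_isHomogeneous hp.homogeneous, h0] at ht
  have h4 := (mul_eq_zero.1 ((mul_eq_zero.1 ht).resolve_left (pow_ne_zero _ ht1))).resolve_left
    hp.pos.ne'
  rw [Multiset.prod_eq_zero_iff, Multiset.mem_map] at h4
  obtain ⟨a, ha, h5⟩ := h4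
  -- A negative root `t` forces an eigenvalue above `1`, too large for the unit ball.
  have h6 : a = 1 - t := by
    field_simp at h5
    linarith
  have h7 : a ^ 2 ≤ (l.map (· ^ 2)).sum :=
    Multiset.single_le_sum (by simp only [Multiset.mem_map]; rintro _ ⟨a, _, rfl⟩; positivity) _
      (Multiset.mem_map_of_mem _ ha)
  nlinarith

theorem IsHyperbolic.gradLog_eq_zero (hp : IsHyperbolic p d z) {h : Fin n → ℝ}
    (hh : h ∈ hyperbolicityCone p z) (hh' : -h ∈ hyperbolicityCone p z) : gradLog p z h = 0 := by
  have h1 := (hp.negHessLog_le_sq hh).1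
  have h2 := (hp.negHessLog_le_sq hh').1
  rw [map_neg] at h2
  linarith

/-- Along a lineality direction the derivative of `log p` vanishes, so the squared eigenvalues sum
to zero. -/
theorem IsHyperbolic.eval_add_eq (hp : IsHyperbolic p d z) {h : Fin n → ℝ}
    (hh : h ∈ hyperbolicityCone p z) (hh' : -h ∈ hyperbolicityCone p z) :
    eval (z + h) p = eval z p := by
  have h1 := (hp.negHessLog_le_sq hh).2
  rw [hp.gradLog_eq_zero hh hh'] at h1
  obtain ⟨l, h0, -, h2⟩ := hp.exists_spectrum h
  have h3 : ∀ a ∈ l, a = 0 := by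
    intro a ha
    have h7 : a ^ 2 ≤ (l.map (· ^ 2)).sum :=
      Multiset.single_le_sum (by simp only [Multiset.mem_map]; rintro _ ⟨a, _, rfl⟩; positivity) _
        (Multiset.mem_map_of_mem _ ha)
    have : a ^ 2 ≤ 0 := by linarith
    exact pow_eq_zero_iff two_ne_zero |>.1 (this.antisymm (sq_nonneg a))
  have h4 := h0 1
  rw [one_smul] at h4
  rw [h4, Multiset.prod_eq_one, mul_one]
  simp only [Multiset.mem_map]
  rintro _ ⟨a, ha, rfl⟩
  rw [h3 a ha]
  ring

theorem IsHyperbolic.gradLog_self (hp : IsHyperbolic p d z) : gradLog p z z = d := by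
  have h1 := coeff_one_lineRestrict p hp.pos.ne' z
  have h2 : lineRestrict p z z = Polynomial.C (eval z p) * (1 + Polynomial.X) ^ d := by
    refine Polynomial.funext fun s => ?_
    have : z + s • z = (1 + s) • z := by rw [add_smul, one_smul]
    rw [eval_lineRestrict_real, this, eval_smul_of_isHomogeneous hp.homogeneous]
    simp [mul_comm]
  rw [h2, Polynomial.coeff_C_mul, Polynomial.coeff_one_add_X_pow] at h1
  simpa using (mul_left_cancel₀ hp.pos.ne' h1).symm

theorem gradLog_eq_zero_of_isLocalMax (hz : eval z p ≠ 0) {h : Fin n → ℝ}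
    (hmax : IsLocalMax (fun s : ℝ => eval (z + s • h) p) 0) : gradLog p z h = 0 := by
  have h1 := (lineRestrict p z h).hasDerivAt 0
  simp only [eval_lineRestrict_real] at h1
  have h2 := hmax.hasDerivAt_eq_zero h1
  rw [← Polynomial.coeff_zero_eq_eval_zero, Polynomial.coeff_derivative,
    coeff_one_lineRestrict p hz] at h2
  simpa [hz] using h2

end Barrier

/-! ### Realizing a dual interior point as a gradient -/

section Maximizer

open MvPolynomial

variable {n d : ℕ} {p : MvPolynomial (Fin n) ℝ} {e : Fin n → ℝ}

/-- The lineality space of the hyperbolicity cone. -/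
def IsHyperbolic.linealitySpace (hp : IsHyperbolic p d e) : Submodule ℝ (Fin n → ℝ) where
  carrier := {x | x ∈ hyperbolicityCone p e ∧ -x ∈ hyperbolicityCone p e}
  zero_mem' := by
    have h := hp.smul_mem (hp.mem_openHyperbolicityCone_iff.1 hp.self_mem).1 le_rfl
    rw [zero_smul] at h
    exact ⟨h, by simpa using h⟩
  add_mem' {x y} hx hy := ⟨hp.add_mem hx.1 hy.1, by
    rw [neg_add]
    exact hp.add_mem hx.2 hy.2⟩
  smul_mem' c x hx := by
    rcases le_total 0 c with hc | hc
    · exact ⟨hp.smul_mem hx.1 hc, by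
        rw [← smul_neg]
        exact hp.smul_mem hx.2 hc⟩
    · have hc' : 0 ≤ -c := by linarith
      refine ⟨?_, ?_⟩
      · rw [← neg_smul_neg]
        exact hp.smul_mem hx.2 hc'
      · rw [← neg_smul]
        exact hp.smul_mem hx.1 hc'

/-- A linear functional in the relative interior of the dual of the hyperbolicity cone is the
derivative of `log p` at a point of the open hyperbolicity cone. -/
theorem IsHyperbolic.exists_gradLog_eq (hp : IsHyperbolic p d e) (hd : d ≠ 0)
    (φ : (Fin n → ℝ) →ₗ[ℝ] ℝ) (hφ : ∀ x ∈ hyperbolicityCone p e, 0 ≤ φ x)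
    (hφ' : ∀ x ∈ hyperbolicityCone p e, φ x = 0 → -x ∈ hyperbolicityCone p e) :
    ∃ z ∈ openHyperbolicityCone p e, gradLog p z = φ := by
  obtain ⟨W, hW⟩ := Submodule.exists_isCompl hp.linealitySpace
  have hdpos : (0 : ℝ) < d := by positivity
  have hφc : Continuous φ := φ.continuous_of_finiteDimensional
  have hWc : IsClosed (W : Set (Fin n → ℝ)) := W.closed_of_finiteDimensional
  have hpos : ∀ x ∈ hyperbolicityCone p e, x ∈ W → x ≠ 0 → 0 < φ x := by
    intro x hx hxW hx0
    refine (hφ x hx).lt_of_ne fun h => hx0 ?_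
    have : x ∈ hp.linealitySpace ⊓ W := ⟨⟨hx, hφ' x hx h.symm⟩, hxW⟩
    rwa [hW.inf_eq_bot, Submodule.mem_bot] at this
  -- Restricting to `W` makes the slice compact. The level `d` makes the Lagrange multiplier `1`, by
  -- Euler's identity `gradLog_self`.
  set T : Set (Fin n → ℝ) := hyperbolicityCone p e ∩ W ∩ {x | φ x = d} with hT
  have hTclosed : IsClosed T :=
    (hp.isClosed_hyperbolicityCone.inter hWc).inter (isClosed_eq hφc continuous_const)
  have hTcompact : IsCompact T := by
    have hS : IsCompact (hyperbolicityCone p e ∩ W ∩ Metric.sphere 0 1) :=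
      (isCompact_sphere 0 1).inter_left (hp.isClosed_hyperbolicityCone.inter hWc)
    obtain ⟨c, hc, hcS⟩ := hS.exists_forall_le' hφc.continuousOn (a := 0) fun x hx =>
      hpos x hx.1.1 hx.1.2 (by rintro rfl; simpa using hx.2)
    refine (isCompact_closedBall 0 (d / c)).of_isClosed_subset hTclosed fun x hx => ?_
    rw [mem_closedBall_zero_iff, le_div_iff₀ hc]
    rcases eq_or_ne x 0 with rfl | hx0
    · simp
    · have hx' : 0 < ‖x‖ := norm_pos_iff.2 hx0
      have := hcS (‖x‖⁻¹ • x) ⟨⟨hp.smul_mem hx.1.1 (by positivity), W.smul_mem _ hx.1.2⟩, by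
        simp [norm_smul, hx'.ne']⟩
      have h1 : φ x = d := hx.2
      rw [map_smul, h1, smul_eq_mul, ← div_eq_inv_mul, le_div_iff₀ hx'] at this
      linarith
  obtain ⟨w₀, hw₀T, hw₀⟩ : ∃ w ∈ T, 0 < eval w p := by
    obtain ⟨l, hl, w, hw, hlw⟩ : ∃ l ∈ hp.linealitySpace, ∃ w ∈ W, l + w = e :=
      Submodule.mem_sup.1 (hW.sup_eq_top ▸ Submodule.mem_top)
    have hwe : w = e + -l := by rw [← hlw]; abel
    have hwC : w ∈ hyperbolicityCone p e := by
      rw [hwe]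
      exact hp.add_mem (hp.mem_openHyperbolicityCone_iff.1 hp.self_mem).1 hl.2
    have hwp : eval w p = eval e p := by
      rw [hwe]
      exact hp.eval_add_eq hl.2 (by rw [neg_neg]; exact hl.1)
    have hw0 : w ≠ 0 := by
      rintro rfl
      have := eval_smul_of_isHomogeneous hp.homogeneous 0 (0 : Fin n → ℝ)
      rw [smul_zero, zero_pow hd, zero_mul, hwp] at this
      exact hp.pos.ne' this
    have hφw := hpos w hwC hw hw0
    refine ⟨(d / φ w) • w, ⟨⟨hp.smul_mem hwC (by positivity), W.smul_mem _ hw⟩, ?_⟩, ?_⟩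
    · change φ ((d / φ w) • w) = d
      rw [map_smul, smul_eq_mul, div_mul_cancel₀ _ hφw.ne']
    · rw [eval_smul_of_isHomogeneous hp.homogeneous, hwp]
      have := hp.pos
      positivity
  obtain ⟨z, hzT, hzmax⟩ := hTcompact.exists_isMaxOn ⟨w₀, hw₀T⟩
    (MvPolynomial.continuous_eval p).continuousOn
  have hzpos : eval z p ≠ 0 := (hw₀.trans_le (hzmax hw₀T)).ne'
  have hz : z ∈ openHyperbolicityCone p e := hp.mem_openHyperbolicityCone_iff.2 ⟨hzT.1.1, hzpos⟩
  have hpz := hp.of_mem hz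
  have hcone := hp.hyperbolicityCone_eq hz
  have hφz : φ z = d := hzT.2
  refine ⟨z, hz, ?_⟩
  have hL : ∀ l ∈ hp.linealitySpace, gradLog p z l = φ l := by
    intro l hl
    rw [hpz.gradLog_eq_zero (by rw [hcone]; exact hl.1) (by rw [hcone]; exact hl.2)]
    have h1 := hφ l hl.1
    have h2 := hφ (-l) hl.2
    rw [map_neg] at h2
    linarith
  -- The Dikin ellipsoid keeps `z + s w` in `T` for small `s`, so `z` is a two-sided local maximum.
  have hker : ∀ w ∈ W, φ w = 0 → gradLog p z w = 0 := by
    intro w hw hφw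
    refine gradLog_eq_zero_of_isLocalMax hzpos ?_
    have hc : Continuous fun s : ℝ => s ^ 2 * negHessLog p z w w := by fun_prop
    have h1 : ∀ᶠ s : ℝ in nhds 0, s ^ 2 * negHessLog p z w w < 1 :=
      hc.continuousAt.eventually_lt continuousAt_const (by simp)
    filter_upwards [h1] with s hs
    have h2 : z + s • w ∈ hyperbolicityCone p e := by
      have := hpz.sub_mem (h := (-s) • w) (by
        simp only [map_smul, LinearMap.smul_apply, smul_eq_mul]
        linarith)
      rw [hcone] at this
      rwa [neg_smul, sub_neg_eq_add] at this
    have h3 : z + s • w ∈ T := ⟨⟨h2, W.add_mem hzT.1.2 (W.smul_mem _ hw)⟩, by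
      change φ (z + s • w) = d
      rw [map_add, map_smul, hφw, hφz]
      simp⟩
    simpa using hzmax h3
  have hWφ : ∀ w ∈ W, gradLog p z w = φ w := by
    intro w hw
    have h1 := hker (w - (φ w / d) • z) (W.sub_mem hw (W.smul_mem _ hzT.1.2)) (by
      rw [map_sub, map_smul, hφz, smul_eq_mul, div_mul_cancel₀ _ hdpos.ne', sub_self])
    rw [map_sub, map_smul, hpz.gradLog_self, smul_eq_mul, div_mul_cancel₀ _ hdpos.ne'] at h1
    linarith
  refine LinearMap.ext fun x => ?_
  obtain ⟨l, hl, w, hw, rfl⟩ : ∃ l ∈ hp.linealitySpace, ∃ w ∈ W, l + w = x :=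
    Submodule.mem_sup.1 (hW.sup_eq_top ▸ Submodule.mem_top)
  rw [map_add, map_add, hL l hl, hWφ w hw]

end Maximizer

/-! ### Approximate Carathéodory for a positive semidefinite form -/

section Sparsification

variable {V : Type*} [AddCommGroup V] [Module ℝ V]

/-- A functional vanishing on the isotropic vectors of a positive semidefinite form is represented by
that form. -/
theorem LinearMap.BilinForm.exists_eq_of_forall_isotropic [FiniteDimensional ℝ V]
    (H : LinearMap.BilinForm ℝ V) (hsymm : ∀ x y, H x y = H y x) (f : V →ₗ[ℝ] ℝ)
    (hf : ∀ x, H x x = 0 → f x = 0) : ∃ r, H r = f := by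
  have h1 : f ∈ (LinearMap.ker H).dualAnnihilator := by
    rw [Submodule.mem_dualAnnihilator]
    intro x hx
    refine hf x ?_
    rw [LinearMap.mem_ker.1 hx, LinearMap.zero_apply]
  rw [← LinearMap.range_dualMap_eq_dualAnnihilator_ker] at h1
  obtain ⟨g, hg⟩ := h1
  obtain ⟨r, rfl⟩ := (Module.evalEquiv ℝ V).surjective g
  refine ⟨r, ?_⟩
  rw [← hg]
  ext x
  simp [hsymm r x]

/-- Approximate Carathéodory: a greedy choice of `N` vectors out of a family with barycenter zero and
average squared length at most one. -/
theorem exists_multiplicities {ι : Type*} [Fintype ι] [DecidableEq ι]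
    (H : LinearMap.BilinForm ℝ V) (hsymm : ∀ x y, H x y = H y x)
    (q : ι → ℝ) (hq : ∀ i, 0 ≤ q i) (hq1 : ∑ i, q i = 1) (D : ι → V)
    (hD0 : ∑ i, q i • D i = 0) (hD1 : ∑ i, q i * H (D i) (D i) ≤ 1) (N : ℕ) :
    ∃ c : ι → ℕ, ∑ i, c i = N ∧ (∀ i, c i ≠ 0 → 0 < q i) ∧
      H (∑ i, (c i : ℝ) • D i) (∑ i, (c i : ℝ) • D i) ≤ N := by
  induction N with
  | zero => exact ⟨0, by simp, by simp, by simp⟩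
  | succ N ih =>
    obtain ⟨c, hc, hcq, hcN⟩ := ih
    set S := ∑ i, (c i : ℝ) • D i with hS
    obtain ⟨i, hi, hi1⟩ : ∃ i, 0 < q i ∧ H (S + D i) (S + D i) ≤ H S S + 1 := by
      by_contra! hcon
      have h1 : ∑ i, q i * (H S S + 1) < ∑ i, q i * H (S + D i) (S + D i) := by
        refine Finset.sum_lt_sum (fun i _ => ?_) ?_
        · rcases (hq i).eq_or_lt with h | h
          · simp [← h]
          · exact (mul_lt_mul_of_pos_left (hcon i h) h).le
        · obtain ⟨i, -, hi⟩ := Finset.exists_lt_of_sum_lt (s := Finset.univ) (f := fun _ => (0 : ℝ))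
            (g := q) (by simp [hq1])
          exact ⟨i, Finset.mem_univ i, mul_lt_mul_of_pos_left (hcon i hi) hi⟩
      -- The cross term averages to zero, so on average the squared length grows by at most `1`.
      have h2 : ∑ i, q i * H (S + D i) (S + D i) =
          H S S + 2 * H S (∑ i, q i • D i) + ∑ i, q i * H (D i) (D i) := by
        have : ∀ i, q i * H (S + D i) (S + D i) =
            q i * H S S + 2 * (q i * H S (D i)) + q i * H (D i) (D i) := by
          intro i
          simp only [map_add, LinearMap.add_apply, hsymm (D i) S]
          ring
        simp only [this, Finset.sum_add_distrib, map_sum, map_smul, smul_eq_mul]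
        rw [← Finset.sum_mul, hq1, one_mul, ← Finset.mul_sum]
      rw [h2, hD0, map_zero, ← Finset.sum_mul, hq1] at h1
      linarith
    refine ⟨c + Pi.single i 1, ?_, ?_, ?_⟩
    · simp [Finset.sum_add_distrib, hc]
    · intro j hj
      by_cases hij : j = i
      · exact hij ▸ hi
      · exact hcq j (by simpa [hij] using hj)
    · have h1 : ∑ j, (((c + Pi.single i 1 : ι → ℕ) j : ℕ) : ℝ) • D j = S + D i := by
        simp only [Pi.add_apply, Nat.cast_add, add_smul, Finset.sum_add_distrib, hS]
        congr 1
        rw [Finset.sum_eq_single i]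
        · simp
        · intro j _ hj
          simp [hj]
        · simp
      rw [h1]
      push_cast
      linarith

/-- Sparsification of a sum of functionals that are dominated by a positive semidefinite form. -/
theorem exists_sparse_approximation [FiniteDimensional ℝ V]
    (H : LinearMap.BilinForm ℝ V) (hsymm : ∀ x y, H x y = H y x) (hH : ∀ x, 0 ≤ H x x)
    {m : ℕ} (f : Fin m → V →ₗ[ℝ] ℝ) (w : Fin m → ℝ) (hw : ∀ i, 0 ≤ w i)
    (hf : ∀ i x, f i x ≤ w i * √(H x x)) {d : ℝ} (hd : 0 < d) (hwd : ∑ i, w i = d)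
    {ε : ℝ} (hε : 0 < ε) {N : ℕ} (hN : (d / ε) ^ 2 ≤ N) :
    ∃ (S : Finset (Fin m)) (c : Fin m → ℝ), S.card ≤ N ∧ (∀ i ∈ S, 0 < c i) ∧
      ∀ x, |∑ i ∈ S, c i * f i x - ∑ i, f i x| ≤ ε * √(H x x) := by
  classical
  have hN0 : (0 : ℝ) < N := lt_of_lt_of_le (by positivity) hN
  have hf0 : ∀ i x, H x x = 0 → f i x = 0 := by
    intro i x hx
    have h1 := hf i x
    have h2 := hf i (-x)
    simp only [map_neg, LinearMap.neg_apply, neg_neg, hx, Real.sqrt_zero, mul_zero] at h1 h2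
    linarith
  have hfw : ∀ i x, w i = 0 → f i x = 0 := by
    intro i x hx
    have h1 := hf i x
    have h2 := hf i (-x)
    simp only [map_neg, hx, zero_mul] at h1 h2
    linarith
  choose r hr using fun i => H.exists_eq_of_forall_isotropic hsymm (f i) (hf0 i)
  have hrr : ∀ i, H (r i) (r i) ≤ w i ^ 2 := by
    intro i
    have h1 := hf i (r i)
    rw [← hr i] at h1
    have h2 := Real.sq_sqrt (hH (r i))
    have h3 := Real.sqrt_nonneg (H (r i) (r i))
    set s := √(H (r i) (r i))
    have h4 : s ≤ w i := by
      rcases h3.eq_or_lt with h | h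
      · rw [← h]; exact hw i
      · nlinarith
    nlinarith
  -- If `w i = 0`, then `f i = 0` by `hfw`, and the default inverse `0` gives `v i = 0`.
  set v : Fin m → V := fun i => (w i)⁻¹ • r i with hv
  have hvv : ∀ i, H (v i) (v i) ≤ 1 := by
    intro i
    simp only [hv, map_smul, LinearMap.smul_apply, smul_eq_mul]
    rcases (hw i).eq_or_lt with h | h
    · simp [← h]
    · have := hrr i
      rw [← mul_assoc, ← mul_inv, inv_mul_le_iff₀ (by positivity)]
      linarith [sq (w i)]
  set q : Fin m → ℝ := fun i => w i / d with hq
  have hq0 : ∀ i, 0 ≤ q i := fun i => div_nonneg (hw i) hd.le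
  have hq1 : ∑ i, q i = 1 := by
    rw [hq, ← Finset.sum_div, hwd, div_self hd.ne']
  set b := ∑ i, q i • v i with hb
  have hD0 : ∑ i, q i • (v i - b) = 0 := by
    simp only [smul_sub, Finset.sum_sub_distrib, ← Finset.sum_smul, hq1, one_smul, ← hb, sub_self]
  have hD1 : ∑ i, q i * H (v i - b) (v i - b) ≤ 1 := by
    have h1 : ∀ i, q i * H (v i - b) (v i - b) =
        q i * H (v i) (v i) - 2 * (q i * H b (v i)) + q i * H b b := by
      intro i
      simp only [map_sub, LinearMap.sub_apply, hsymm (v i) b]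
      ring
    have h2 : ∑ i, q i * H b (v i) = H b b := by
      conv_rhs => rw [hb, map_sum]
      simp only [map_smul, smul_eq_mul]
      rw [← hb]
    simp only [h1, Finset.sum_add_distrib, Finset.sum_sub_distrib]
    rw [← Finset.mul_sum, h2, ← Finset.sum_mul, hq1]
    have h3 : ∑ i, q i * H (v i) (v i) ≤ ∑ i, q i :=
      Finset.sum_le_sum fun i _ => mul_le_of_le_one_right (hq0 i) (hvv i)
    linarith [hH b]
  obtain ⟨c, hcN, hcq, hcH⟩ := exists_multiplicities H hsymm q hq0 hq1 _ hD0 hD1 N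
  set R := ∑ i, (c i : ℝ) • (v i - b) with hR
  have hHv : ∀ i x, H (v i) x = (w i)⁻¹ * f i x := by
    intro i x
    simp only [hv, map_smul, LinearMap.smul_apply, smul_eq_mul, hr]
  have hHb : ∀ x, H b x = (∑ i, f i x) / d := by
    intro x
    simp only [hb, map_sum, map_smul, LinearMap.sum_apply, LinearMap.smul_apply, smul_eq_mul, hHv,
      Finset.sum_div]
    refine Finset.sum_congr rfl fun i _ => ?_
    by_cases h : w i = 0
    · simp [hfw i x h]
    · simp only [hq]
      field_simp
  have hHR : ∀ x, H R x = ∑ i, c i * ((w i)⁻¹ * f i x) - N * ((∑ i, f i x) / d) := by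
    intro x
    have : (N : ℝ) = ∑ i, (c i : ℝ) := by rw [← hcN]; push_cast; rfl
    rw [this, Finset.sum_mul, ← Finset.sum_sub_distrib]
    simp only [hR, map_sum, map_smul, map_sub, LinearMap.sum_apply, LinearMap.smul_apply,
      LinearMap.sub_apply, smul_eq_mul, hHv, hHb, mul_sub]
  -- The factor `d / N` undoes the averaging and the normalization: the error becomes `d / N * H R
  -- x`, bounded by Cauchy–Schwarz.
  refine ⟨Finset.univ.filter fun i => c i ≠ 0, fun i => d / N * (c i * (w i)⁻¹), ?_, ?_, ?_⟩
  · rw [← hcN, Finset.card_eq_sum_ones, Finset.sum_filter]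
    refine Finset.sum_le_sum fun i _ => ?_
    split_ifs with h
    · exact Nat.one_le_iff_ne_zero.2 h
    · exact Nat.zero_le _
  · intro i hi
    have hi := (Finset.mem_filter.1 hi).2
    have hwi : 0 < w i := (div_pos_iff_of_pos_right hd).1 (hcq i hi)
    have : (0 : ℝ) < c i := by exact_mod_cast Nat.pos_of_ne_zero hi
    positivity
  · intro x
    have h1 : ∑ i ∈ Finset.univ.filter (fun i => c i ≠ 0), d / N * (c i * (w i)⁻¹) * f i x =
        ∑ i, d / N * (c i * (w i)⁻¹) * f i x := by
      refine Finset.sum_subset (Finset.filter_subset _ _) fun i _ hi => ?_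
      have : c i = 0 := by simpa using hi
      simp [this]
    have h2 : ∑ i, d / N * (c i * (w i)⁻¹) * f i x - ∑ i, f i x = d / N * H R x := by
      rw [hHR, mul_sub, Finset.mul_sum]
      congr 1
      · exact Finset.sum_congr rfl fun i _ => by ring
      · field_simp
    rw [h1, h2]
    have h3 := LinearMap.BilinForm.apply_sq_le_of_symm H hH ⟨fun x y => hsymm x y⟩ R x
    have h4 : |d / N * H R x| ≤ √((ε * √(H x x)) ^ 2) := by
      refine Real.abs_le_sqrt ?_
      rw [mul_pow, mul_pow, Real.sq_sqrt (hH x)]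
      have h5 : H R x ^ 2 ≤ N * H x x := h3.trans (mul_le_mul_of_nonneg_right hcH (hH x))
      have h6 : d ^ 2 ≤ ε ^ 2 * N := by
        rw [div_pow, div_le_iff₀ (by positivity)] at hN
        linarith
      calc (d / N) ^ 2 * H R x ^ 2 ≤ (d / N) ^ 2 * (N * H x x) := by gcongr
        _ = d ^ 2 / N * H x x := by field_simp
        _ ≤ ε ^ 2 * H x x := by
          refine mul_le_mul_of_nonneg_right ?_ (hH x)
          rwa [div_le_iff₀ hN0]
    rwa [Real.sqrt_sq (by positivity)] at h4

end Sparsification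

/-! ### Relative interiors and the infimum of sparsification functions -/

section Cone

variable {V : Type*} [NormedAddCommGroup V] [NormedSpace ℝ V]

theorem exists_add_smul_sub_mem_of_mem_intrinsicInterior {K : Set V} {a y : V}
    (ha : a ∈ intrinsicInterior ℝ K) (hy : y ∈ K) : ∃ δ : ℝ, 0 < δ ∧ a + δ • (a - y) ∈ K := by
  obtain ⟨b, hb, rfl⟩ := mem_intrinsicInterior.1 ha
  have hmem : ∀ δ : ℝ, AffineMap.lineMap (b : V) y (-δ) ∈ affineSpan ℝ K := fun δ =>
    AffineMap.lineMap_mem _ b.2 (subset_affineSpan ℝ K hy)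
  set g : ℝ → affineSpan ℝ K := fun δ => ⟨_, hmem δ⟩ with hg
  have hc : Continuous g := (AffineMap.lineMap_continuous.comp continuous_neg).subtype_mk _
  have h0 : g 0 = b := Subtype.ext (by simp [hg])
  have h1 : ∀ᶠ δ in nhds 0, g δ ∈ ((↑) ⁻¹' K : Set (affineSpan ℝ K)) := by
    refine hc.continuousAt.eventually_mem ?_
    rw [h0]
    exact mem_interior_iff_mem_nhds.1 hb
  obtain ⟨r, hr, h⟩ := Metric.eventually_nhds_iff.1 h1
  refine ⟨r / 2, by positivity, ?_⟩
  have : AffineMap.lineMap (b : V) y (-(r / 2)) ∈ K := h (y := r / 2) (by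
    rw [dist_zero_right, Real.norm_eq_abs, abs_of_pos (by positivity)]
    linarith)
  rw [AffineMap.lineMap_apply, vsub_eq_sub, vadd_eq_add] at this
  convert this using 1
  module

variable {K : PointedCone ℝ V}

/-- The relative interior is nonempty, so a one-element family tests `α`. This makes the real
infimum defining `sp` bounded below. -/
theorem IsSparsificationFunction.nonneg [FiniteDimensional ℝ V] {α : Set.Ioo (0 : ℝ) 1 → ℝ}
    (hα : IsSparsificationFunction K α) (ε : Set.Ioo (0 : ℝ) 1) : 0 ≤ α ε := by
  obtain ⟨a, ha⟩ := Set.Nonempty.intrinsicInterior K.convex ⟨0, K.zero_mem⟩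
  obtain ⟨S, c, hS, -⟩ := hα.sparsifies 1 (fun _ => a) (fun _ => intrinsicInterior_subset ha)
    (by simpa using ha) ε
  exact (Nat.cast_nonneg _).trans hS

theorem bddBelow_sparsificationFunction [FiniteDimensional ℝ V] (ε : Set.Ioo (0 : ℝ) 1) :
    BddBelow (Set.range fun α : {α // IsSparsificationFunction K α} => α.1 ε) :=
  ⟨0, by rintro _ ⟨α, rfl⟩; exact α.2.nonneg ε⟩

/-- `sp K` is below every sparsification function. -/
theorem IsSparsificationFunction.sp_le [FiniteDimensional ℝ V] {α : Set.Ioo (0 : ℝ) 1 → ℝ}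
    (hα : IsSparsificationFunction K α) (ε : Set.Ioo (0 : ℝ) 1) : sp K ε ≤ α ε :=
  ciInf_le (bddBelow_sparsificationFunction ε) ⟨α, hα⟩

/-- If there is a sparsification function, `sp K` is one. -/
theorem IsSparsificationFunction.isSparsificationFunction_sp [FiniteDimensional ℝ V]
    {α : Set.Ioo (0 : ℝ) 1 → ℝ} (hα : IsSparsificationFunction K α) :
    IsSparsificationFunction K (sp K) := by
  have : Nonempty {α // IsSparsificationFunction K α} := ⟨⟨α, hα⟩⟩
  refine ⟨fun ε ε' h => ?_, ?_, fun m x hx hsum ε => ?_⟩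
  · exact ciInf_mono (bddBelow_sparsificationFunction ε') fun β => β.2.antitone h
  · exact upperSemicontinuous_ciInf bddBelow_sparsificationFunction
      fun β => β.2.upperSemicontinuous
  -- Cardinalities are integers: a `β` below `⌊sp K ε⌋ + 1` already gives `S.card ≤ sp K ε`, even if
  -- the infimum is not attained.
  · obtain ⟨β, hβ⟩ := exists_lt_of_ciInf_lt (Int.lt_floor_add_one (sp K ε))
    obtain ⟨S, c, hS, h⟩ := β.2.sparsifies m x hx hsum ε
    refine ⟨S, c, ?_, h⟩
    have h1 : ((S.card : ℤ) : ℝ) < ((⌊sp K ε⌋ + 1 : ℤ) : ℝ) := by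
      push_cast
      exact hS.trans_lt hβ
    have h2 : (S.card : ℤ) ≤ ⌊sp K ε⌋ := Int.lt_add_one_iff.1 (Int.cast_lt.1 h1)
    exact_mod_cast Int.le_floor.1 h2

end Cone

/-! ### Sparsification in the dual of the hyperbolicity cone -/

section HyperbolicDual

open MvPolynomial

variable {n d : ℕ} {p : MvPolynomial (Fin n) ℝ} {e : Fin n → ℝ}

/-- A functional nonnegative on the hyperbolicity cone is dominated by the Hessian norm at `z`. -/
theorem IsHyperbolic.le_mul_sqrt_negHessLog {z : Fin n → ℝ} (hp : IsHyperbolic p d z)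
    (f : (Fin n → ℝ) →ₗ[ℝ] ℝ) (hf : ∀ x ∈ hyperbolicityCone p z, 0 ≤ f x) (x : Fin n → ℝ) :
    f x ≤ f z * √(negHessLog p z x x) := by
  set s := √(negHessLog p z x x) with hs
  have hs0 : 0 ≤ s := Real.sqrt_nonneg _
  -- The slack `a` allows division by `s + a` even when `x` is isotropic.
  have key : ∀ a : ℝ, 0 < a → f x ≤ f z * (s + a) := by
    intro a ha
    have hb : 0 < s + a := by linarith
    have h1 := hf _ (hp.sub_mem (h := (s + a)⁻¹ • x) (by
      simp only [map_smul, LinearMap.smul_apply, smul_eq_mul]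
      rw [← Real.sq_sqrt (hp.negHessLog_nonneg x), ← hs, ← mul_assoc, ← mul_inv,
        inv_mul_le_iff₀ (by positivity)]
      nlinarith))
    rw [map_sub, map_smul, smul_eq_mul, sub_nonneg, inv_mul_le_iff₀ hb] at h1
    linarith
  simpa using le_apply_zero_of_forall_pos (f := fun a => f z * (s + a)) (by fun_prop) key

/-- The hyperbolicity cone as a proper cone. -/
def IsHyperbolic.properCone (hp : IsHyperbolic p d e) : ProperCone ℝ (Fin n → ℝ) where
  carrier := hyperbolicityCone p e
  add_mem' := hp.add_mem
  zero_mem' := hp.linealitySpace.zero_mem.1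
  smul_mem' c _ hx := hp.smul_mem hx c.2
  isClosed' := hp.isClosed_hyperbolicityCone

variable (B : (Fin n → ℝ) →ₗ[ℝ] (Fin n → ℝ) →ₗ[ℝ] ℝ)

/-- Otherwise a dual vector `y` is strictly positive on `x`; moving from `a` slightly away from `y`
would leave the dual cone. -/
theorem IsHyperbolic.neg_mem_of_mem_intrinsicInterior_dual (hp : IsHyperbolic p d e)
    (hB_symm : ∀ x y, B x y = B y x) (hB_pos : ∀ x, x ≠ 0 → 0 < B x x) {a : Fin n → ℝ}
    (ha : a ∈ intrinsicInterior ℝ (PointedCone.dual B (hyperbolicityCone p e) : Set (Fin n → ℝ)))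
    {x : Fin n → ℝ} (hx : x ∈ hyperbolicityCone p e) (hax : B x a = 0) :
    -x ∈ hyperbolicityCone p e := by
  by_contra hneg
  obtain ⟨f, hf, hfx⟩ := hp.properCone.hyperplane_separation_point (x₀ := -x) hneg
  obtain ⟨y, hy⟩ := LinearMap.BilinForm.exists_eq_of_forall_isotropic B hB_symm f.toLinearMap
    fun x hx => by
      by_cases h : x = 0
      · simp [h]
      · exact absurd hx (hB_pos x h).ne'
  have hyf : ∀ u, B u y = f u := fun u => by rw [hB_symm, hy]; rfl
  have hyK : y ∈ PointedCone.dual B (hyperbolicityCone p e) := fun u hu => by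
    rw [hyf]
    exact hf u hu
  obtain ⟨δ, hδ, h⟩ := exists_add_smul_sub_mem_of_mem_intrinsicInterior ha hyK
  have h1 := h hx
  rw [map_add, map_smul, map_sub, hax, hyf, smul_eq_mul] at h1
  rw [map_neg] at hfx
  nlinarith

theorem IsHyperbolic.eq_zero_of_mem_dual (hp : IsHyperbolic p 0 e)
    (hB_pos : ∀ x, x ≠ 0 → 0 < B x x) {y : Fin n → ℝ}
    (hy : y ∈ PointedCone.dual B (hyperbolicityCone p e)) : y = 0 := by
  have hconst : ∀ x, eval x p = eval e p := fun x => by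
    have h1 := eval_smul_of_isHomogeneous hp.homogeneous 0 x
    have h2 := eval_smul_of_isHomogeneous hp.homogeneous 0 e
    rw [zero_smul, pow_zero, one_mul] at h1 h2
    rw [← h1, h2]
  by_contra h
  have h1 : 0 ≤ B (-y) y := hy fun t ht => absurd (hconst _ ▸ ht) hp.pos.ne'
  rw [map_neg, LinearMap.neg_apply] at h1
  linarith [hB_pos y h]

/-- The dual of a hyperbolicity cone of degree `d` has the sparsification function `(4d/ε)²`. -/
theorem IsHyperbolic.isSparsificationFunction_dual (hp : IsHyperbolic p d e)
    (hB_symm : ∀ x y, B x y = B y x) (hB_pos : ∀ x, x ≠ 0 → 0 < B x x) :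
    IsSparsificationFunction (PointedCone.dual B (hyperbolicityCone p e))
      fun ε => (4 * (d : ℝ) / (ε : ℝ)) ^ 2 := by
  refine ⟨fun ε ε' h => ?_, ?_, fun m x hx hsum ε => ?_⟩
  · have h1 := ε.2.1
    have h2 : (ε : ℝ) ≤ ε' := h
    have h3 := ε'.2.1
    gcongr
  · refine Continuous.upperSemicontinuous ?_
    -- The bound is left unrounded here: for `d > 0` its ceiling is not upper semicontinuous.
    exact (continuous_const.div continuous_subtype_val fun ε => ε.2.1.ne').pow 2
  have hε0 := ε.2.1
  have hε1 := ε.2.2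
  rcases Nat.eq_zero_or_pos d with rfl | hd
  · have hx0 : ∀ i, x i = 0 := fun i => hp.eq_zero_of_mem_dual B hB_pos (hx i)
    exact ⟨∅, 0, by simp, by simp, by simp [hx0], by simp [hx0]⟩
  have hd1 : (1 : ℝ) ≤ d := by exact_mod_cast hd
  obtain ⟨z, hz, hgrad⟩ := hp.exists_gradLog_eq hd.ne' (B.flip (∑ i, x i))
    (fun u hu => intrinsicInterior_subset hsum hu)
    fun u hu h => hp.neg_mem_of_mem_intrinsicInterior_dual B hB_symm hB_pos hsum hu h
  have hpz := hp.of_mem hz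
  have hcone := hp.hyperbolicityCone_eq hz
  have hgrad' : ∀ u, gradLog p z u = ∑ i, B u (x i) := fun u => by
    rw [hgrad, LinearMap.flip_apply, map_sum]
  -- Only `(d/ε)²` vectors are needed; as `d/ε ≥ 1`, the factor `16` absorbs the loss from the
  -- floor.
  have hN : ((d : ℝ) / ε) ^ 2 ≤ ⌊(4 * (d : ℝ) / (ε : ℝ)) ^ 2⌋₊ := by
    have h1 : 1 ≤ (d : ℝ) / ε := (one_le_div hε0).2 (hε1.le.trans hd1)
    have h2 := Nat.lt_floor_add_one ((4 * (d : ℝ) / (ε : ℝ)) ^ 2)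
    rw [mul_div_assoc] at h2 ⊢
    nlinarith
  obtain ⟨S, c, hS, hc, happrox⟩ := exists_sparse_approximation (negHessLog p z)
    (negHessLog_symm p z) hpz.negHessLog_nonneg (fun i => B.flip (x i)) (fun i => B z (x i))
    (fun i => hx i (hcone ▸ (hpz.mem_openHyperbolicityCone_iff.1 hpz.self_mem).1))
    (fun i u => hpz.le_mul_sqrt_negHessLog _ (fun v hv => hx i (hcone ▸ hv)) u)
    (show (0 : ℝ) < d by linarith) (by rw [← hgrad', hpz.gradLog_self]) hε0 hN
  have key : ∀ u ∈ hyperbolicityCone p e,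
      |∑ i ∈ S, c i * B u (x i) - ∑ i, B u (x i)| ≤ ε * ∑ i, B u (x i) := by
    intro u hu
    obtain ⟨h1, h2⟩ := hpz.negHessLog_le_sq (h := u) (by rwa [hcone])
    refine (happrox u).trans ?_
    rw [← hgrad']
    exact mul_le_mul_of_nonneg_left (Real.sqrt_le_iff.2 ⟨h1, h2⟩) hε0.le
  refine ⟨S, c, (Nat.cast_le.2 hS).trans (Nat.floor_le (by positivity)), hc, ?_, ?_⟩
  · intro u hu
    have := (abs_le.1 (key u hu)).1
    simp only [map_sub, map_smul, map_sum, smul_eq_mul]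
    linarith
  · intro u hu
    have := (abs_le.1 (key u hu)).2
    simp only [map_sub, map_smul, map_sum, smul_eq_mul]
    linarith

end HyperbolicDual

theorem corollary7p2 {n d : ℕ} (p : MvPolynomial (Fin n) ℝ) (e : Fin n → ℝ)
    (hp : IsHyperbolic p d e)
    (B : (Fin n → ℝ) →ₗ[ℝ] (Fin n → ℝ) →ₗ[ℝ] ℝ)
    (hB_symm : ∀ x y, B x y = B y x) (hB_pos : ∀ x, x ≠ 0 → 0 < B x x) :
    IsSparsificationFunction (PointedCone.dual B (hyperbolicityCone p e))
        (sp (PointedCone.dual B (hyperbolicityCone p e))) ∧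
      ∀ ε : Set.Ioo (0 : ℝ) 1,
        sp (PointedCone.dual B (hyperbolicityCone p e)) ε
          ≤ (⌈(4 * (d : ℝ) / (ε : ℝ)) ^ 2⌉ : ℤ) := by
  have h := hp.isSparsificationFunction_dual B hB_symm hB_pos
  exact ⟨h.isSparsificationFunction_sp, fun ε => (h.sp_le ε).trans (Int.le_ceil _)⟩
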